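/- Let $(\Omega,\mathcal F,(\mathcal F_t)_{t\ge 0},P)$ be a filtered probability space, let $W$ be a standard Brownian motion relative to $(\mathcal F_t)$ (that is, $W$ is adapted and $W_t-W_s$ is independent of $\mathcal F_s$ for $s\le t$), and let $\mu<0$, $\sigma>0$, $z>0$. Let $S=(S_t)_{t\ge 0}$ be a geometric Brownian motion with drift $\mu$ and volatility $\sigma$ started at $z$, i.e. a continuous adapted process solving the It\^o stochastic differential equation $$\mathrm{d}S_t=\mu S_t\,\mathrm{d}t+\sigma S_t\,\mathrm{d}W_t,\qquad S_0=z .$$ Then, for every $\alpha>z$, $$P\Bigl(\sup_{t>0}S_t\ge\alpha\Bigr)\le\frac{z}{\alpha}.$$ -/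

import Mathlib

open MeasureTheory ProbabilityTheory Filter Topology
open scoped NNReal ENNReal

/-- `W` is a standard one-dimensional Brownian motion relative to the filtration `F`: it is a
Brownian motion, it is adapted to `F`, and its increments after time `s` are independent
of `F s`. -/
structure IsBrownianMotionWrt {Ω : Type*} {mΩ : MeasurableSpace Ω} (P : Measure Ω)
    (F : Filtration ℝ≥0 mΩ) (W : ℝ≥0 → Ω → ℝ) : Prop where
  isBrownian : IsBrownianReal W P
  adapted : StronglyAdapted F W
  indep : ∀ s t : ℝ≥0, s ≤ t →
    Indep (MeasurableSpace.comap (fun ω ↦ W t ω - W s ω) inferInstance) (F s) P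

/-- `I` is the Itô integral `∫₀ᵗ H dW` of a process `H` with continuous paths that is adapted to a
filtration relative to which `W` is a Brownian motion: `I` is the limit in probability of the
left-endpoint sums `∑ H(t_k) (W(t_{k+1}) - W(t_k))`, along every sequence of partitions
`0 = t_0 ≤ t_1 ≤ … ≤ t_m = t` whose mesh tends to `0`. (The `n`-th partition has `m n` cells,
and its points are `p n 0, …, p n (m n)`; later values of `p n` play no role.) -/
def IsItoIntegral {Ω : Type*} {mΩ : MeasurableSpace Ω} (P : Measure Ω)
    (H W : ℝ≥0 → Ω → ℝ) (t : ℝ≥0) (I : Ω → ℝ) : Prop :=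
  ∀ (m : ℕ → ℕ) (p : ℕ → ℕ → ℝ≥0),
    (∀ n, Monotone (p n)) → (∀ n, p n 0 = 0) → (∀ n, p n (m n) = t) →
    Tendsto (fun n ↦ (Finset.range (m n)).sup fun k ↦ p n (k + 1) - p n k) atTop (𝓝 0) →
    TendstoInMeasure P
      (fun n ω ↦ ∑ k ∈ Finset.range (m n),
        H (p n k) ω * (W (p n (k + 1)) ω - W (p n k) ω))
      atTop I

/-- `S` is a geometric Brownian motion with drift `μ` and volatility `σ`, started at `z` and driven
by the `F`-Brownian motion `W`: a continuous `F`-adapted solution of the stochastic differential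
equation `dS = μ S dt + σ S dW`, `S_0 = z`. -/
structure IsGeometricBrownianMotion {Ω : Type*} {mΩ : MeasurableSpace Ω} (P : Measure Ω)
    (F : Filtration ℝ≥0 mΩ) (W S : ℝ≥0 → Ω → ℝ) (μ σ z : ℝ) : Prop where
  brownian : IsBrownianMotionWrt P F W
  adapted : StronglyAdapted F S
  cont : ∀ᵐ ω ∂P, Continuous fun t ↦ S t ω
  initial : ∀ᵐ ω ∂P, S 0 ω = z
  sde : ∀ t : ℝ≥0, ∃ I : Ω → ℝ, IsItoIntegral P (fun s ω ↦ σ * S s ω) W t I ∧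
    ∀ᵐ ω ∂P, S t ω = S 0 ω + (∫ s in (0 : ℝ)..t, μ * S s.toNNReal ω) + I ω

/-! For `μ ≤ 0` the generator of the SDE sends the positive part to something nonpositive: the drift
contributes `μ x` on `x > 0`, and the kink at `0` is cancelled by the factor `x ^ 2` of the
diffusion term. So `S⁺` behaves like a supermartingale started at `z`, and stopping it on reaching
`β` gives `β * P(β is reached) ≤ z`. Working with `S⁺` makes a proof that `S` is positive
unnecessary.

The Itô integral is only a limit in probability of left-endpoint sums, so the argument runs in
discrete time. Twice the positive part is smoothed to `smoothPos ε`, whose generator is `O(ε)` near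
the diagonal (`smoothPosGen_le_of_near`). The process is replaced by Euler sums with coefficients `S
(k * h)`, set to `0` once `|S|` exceeds `N` or `S` is at least `β` at a coarse grid time. A Taylor
bound and Gaussian moments control one step, hence the terminal mean
(`exists_integral_smoothPos_eulerSum_le`). By the SDE the plain Euler sums converge to `S` in
probability at each fixed time. This suffices: the generator error involves only a time average
(`tendsto_average_measure_eulerSum`), and stopping involves only finitely many coarse times.

Markov's inequality then gives `measureReal_coarse_le`. The limits are taken in the order: fine step
to `0`, `ε → 0`, `N → ∞`, coarse grid to all times, `β ↑ α`. -/

/-! ### The smoothed positive part and its generator -/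

/-- A smooth approximation of `2 * max x 0`. -/
noncomputable def smoothPos (ε x : ℝ) : ℝ := x + √(x ^ 2 + ε ^ 2)

/-- The generator of geometric Brownian motion applied to `smoothPos ε`, with the state `u` in the
coefficients and the state `x` in the derivatives. -/
noncomputable def smoothPosGen (ε μ σ x u : ℝ) : ℝ :=
  (1 + x / √(x ^ 2 + ε ^ 2)) * (μ * u) + ε ^ 2 / (2 * √(x ^ 2 + ε ^ 2) ^ 3) * (σ ^ 2 * u ^ 2)

lemma abs_lt_sqrt_sq_add_sq {ε : ℝ} (hε : 0 < ε) (x : ℝ) : |x| < √(x ^ 2 + ε ^ 2) := by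
  apply Real.lt_sqrt_of_sq_lt
  rw [sq_abs]; nlinarith

lemma le_sqrt_sq_add_sq {ε : ℝ} (x : ℝ) : ε ≤ √(x ^ 2 + ε ^ 2) := by
  apply Real.le_sqrt_of_sq_le
  nlinarith [sq_nonneg x]

lemma two_mul_le_smoothPos (ε x : ℝ) : 2 * x ≤ smoothPos ε x := by
  have : x ≤ √(x ^ 2 + ε ^ 2) := Real.le_sqrt_of_sq_le (by nlinarith [sq_nonneg ε])
  unfold smoothPos; linarith

lemma smoothPos_nonneg (ε x : ℝ) : 0 ≤ smoothPos ε x := by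
  have : -x ≤ √(x ^ 2 + ε ^ 2) := Real.le_sqrt_of_sq_le (by nlinarith [sq_nonneg ε])
  unfold smoothPos; linarith

lemma smoothPos_le {ε : ℝ} (hε : 0 ≤ ε) (x : ℝ) : smoothPos ε x ≤ x + |x| + ε := by
  have : √(x ^ 2 + ε ^ 2) ≤ |x| + ε := by
    rw [Real.sqrt_le_left (by positivity)]
    nlinarith [sq_abs x, abs_nonneg x]
  unfold smoothPos; linarith

lemma continuous_smoothPos (ε : ℝ) : Continuous (smoothPos ε) := by
  unfold smoothPos; fun_prop

/-- The square of the cubic Taylor polynomial exceeds `1 + u` by `u ^ 4 * ((u - 2) ^ 2 + 16) / 256`.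
-/
lemma sqrt_one_add_le_cubic {u : ℝ} (hu : -1 ≤ u) :
    √(1 + u) ≤ 1 + u / 2 - u ^ 2 / 8 + u ^ 3 / 16 := by
  have h0 : 0 ≤ 1 + u / 2 - u ^ 2 / 8 + u ^ 3 / 16 := by
    nlinarith [mul_nonneg (by linarith : 0 ≤ 1 + u) (sq_nonneg (u - 3 / 2))]
  rw [Real.sqrt_le_left h0]
  nlinarith [mul_nonneg (sq_nonneg (u ^ 2)) (sq_nonneg (u - 2)), sq_nonneg (u ^ 2)]

/-- One-sided Taylor estimate of second order. -/
lemma smoothPos_add_le {ε : ℝ} (hε : 0 < ε) (x h : ℝ) :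
    smoothPos ε (x + h) ≤ smoothPos ε x + (1 + x / √(x ^ 2 + ε ^ 2)) * h
      + ε ^ 2 / (2 * √(x ^ 2 + ε ^ 2) ^ 3) * h ^ 2
      + (3 / ε ^ 2 + 1 / ε ^ 5) * (|h| ^ 3 + |h| ^ 6) := by
  set s := √(x ^ 2 + ε ^ 2) with hs
  have hxs : |x| < s := abs_lt_sqrt_sq_add_sq hε x
  have hεs : ε ≤ s := le_sqrt_sq_add_sq x
  have hs0 : 0 < s := hε.trans_le hεs
  have hs2 : s ^ 2 = x ^ 2 + ε ^ 2 := Real.sq_sqrt (by positivity)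
  -- Relative change of `x ^ 2 + ε ^ 2`. As `u` is of first order in `h`, the cubic bound leaves an
  -- error of third order.
  set u := (2 * x * h + h ^ 2) / s ^ 2 with hu
  have hu1 : s ^ 2 * (1 + u) = (x + h) ^ 2 + ε ^ 2 := by
    rw [hu]; field_simp; linarith
  have hu2 : -1 ≤ u := by
    have : 0 ≤ s ^ 2 * (1 + u) := by rw [hu1]; positivity
    have := nonneg_of_mul_nonneg_right this (by positivity)
    linarith
  have h1 : √((x + h) ^ 2 + ε ^ 2) ≤ s * (1 + u / 2 - u ^ 2 / 8 + u ^ 3 / 16) := by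
    rw [← hu1, Real.sqrt_mul (by positivity), Real.sqrt_sq hs0.le]
    exact mul_le_mul_of_nonneg_left (sqrt_one_add_le_cubic hu2) hs0.le
  have h2 : s * (1 + u / 2 - u ^ 2 / 8 + u ^ 3 / 16) = s + x / s * h
      + ε ^ 2 / (2 * s ^ 3) * h ^ 2 + (-(x * h ^ 3) / (2 * s ^ 3) - h ^ 4 / (8 * s ^ 3)
        + (2 * x * h + h ^ 2) ^ 3 / (16 * s ^ 5)) := by
    have : ε ^ 2 = s ^ 2 - x ^ 2 := by linarith
    rw [hu, this]; field_simp; ring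
  have h3 : -(x * h ^ 3) / (2 * s ^ 3) ≤ 1 / ε ^ 2 * |h| ^ 3 := by
    have e1 : -(x * h ^ 3) ≤ s * |h| ^ 3 := by
      calc -(x * h ^ 3) ≤ |x * h ^ 3| := neg_le_abs _
        _ = |x| * |h| ^ 3 := by rw [abs_mul, abs_pow]
        _ ≤ _ := by gcongr
    calc -(x * h ^ 3) / (2 * s ^ 3) ≤ s * |h| ^ 3 / (2 * s ^ 3) := by gcongr
      _ = 1 / (2 * s ^ 2) * |h| ^ 3 := by field_simp
      _ ≤ 1 / ε ^ 2 * |h| ^ 3 := by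
        gcongr
        nlinarith
  have h4 : (2 * x * h + h ^ 2) ^ 3 / (16 * s ^ 5) ≤
      2 / ε ^ 2 * |h| ^ 3 + 1 / ε ^ 5 * |h| ^ 6 := by
    have e1 : (2 * x * h + h ^ 2) ^ 3 ≤ 32 * s ^ 3 * |h| ^ 3 + 4 * |h| ^ 6 := by
      have e2 : 2 * x * h + h ^ 2 ≤ 2 * s * |h| + |h| ^ 2 := by
        rw [sq_abs]
        have : x * h ≤ s * |h| := (le_abs_self _).trans (by rw [abs_mul]; gcongr)
        linarith
      have e3 : (2 * x * h + h ^ 2) ^ 3 ≤ (2 * s * |h| + |h| ^ 2) ^ 3 :=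
        (Odd.pow_le_pow (by decide)).2 e2
      have e4 := add_pow_le (show 0 ≤ 2 * s * |h| by positivity) (show 0 ≤ |h| ^ 2 by positivity) 3
      calc _ ≤ _ := e3
        _ ≤ 2 ^ (3 - 1) * ((2 * s * |h|) ^ 3 + (|h| ^ 2) ^ 3) := e4
        _ = _ := by ring
    calc _ ≤ (32 * s ^ 3 * |h| ^ 3 + 4 * |h| ^ 6) / (16 * s ^ 5) := by gcongr
      _ = 2 / s ^ 2 * |h| ^ 3 + 1 / (4 * s ^ 5) * |h| ^ 6 := by field_simp; ring
      _ ≤ _ := by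
        gcongr
        calc ε ^ 5 ≤ s ^ 5 := by gcongr
          _ ≤ 4 * s ^ 5 := by linarith [pow_pos hs0 5]
  have h5 : 0 ≤ h ^ 4 / (8 * s ^ 3) := by positivity
  have h6 : 0 ≤ 3 / ε ^ 2 * |h| ^ 6 := by positivity
  have h7 : 0 ≤ 1 / ε ^ 5 * |h| ^ 3 := by positivity
  unfold smoothPos
  rw [← hs]
  have : 3 / ε ^ 2 * |h| ^ 3 = 1 / ε ^ 2 * |h| ^ 3 + 2 / ε ^ 2 * |h| ^ 3 := by ring
  linarith

lemma smoothPos_deriv_mem {ε : ℝ} (hε : 0 < ε) (x : ℝ) :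
    0 ≤ 1 + x / √(x ^ 2 + ε ^ 2) ∧ 1 + x / √(x ^ 2 + ε ^ 2) ≤ 2 := by
  have hxs := abs_lt_sqrt_sq_add_sq hε x
  have h : |x / √(x ^ 2 + ε ^ 2)| ≤ 1 := by
    rw [abs_div, abs_of_nonneg (Real.sqrt_nonneg _)]
    exact div_le_one_of_le₀ hxs.le (Real.sqrt_nonneg _)
  rw [abs_le] at h
  constructor <;> linarith

/-- The expression is half the second derivative, the Itô factor `1 / 2` being included. -/
lemma smoothPos_second_deriv_mem {ε : ℝ} (hε : 0 < ε) (x : ℝ) :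
    0 ≤ ε ^ 2 / (2 * √(x ^ 2 + ε ^ 2) ^ 3) ∧ ε ^ 2 / (2 * √(x ^ 2 + ε ^ 2) ^ 3) ≤ 1 / ε := by
  have hεs : ε ≤ √(x ^ 2 + ε ^ 2) := le_sqrt_sq_add_sq x
  set s := √(x ^ 2 + ε ^ 2)
  refine ⟨by positivity, ?_⟩
  rw [div_le_div_iff₀ (by positivity) hε]
  have : ε ^ 3 ≤ s ^ 3 := by gcongr
  nlinarith [pow_pos hε 3]

lemma abs_smoothPosGen_le {ε N : ℝ} (hε : 0 < ε) (μ σ x : ℝ) {u : ℝ} (hu : |u| ≤ N) :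
    |smoothPosGen ε μ σ x u| ≤ 2 * (|μ| * N) + 1 / ε * (σ ^ 2 * N ^ 2) := by
  obtain ⟨a0, a1⟩ := smoothPos_deriv_mem hε x
  obtain ⟨b0, b1⟩ := smoothPos_second_deriv_mem hε x
  unfold smoothPosGen
  refine (abs_add_le _ _).trans (add_le_add ?_ ?_)
  · rw [abs_mul, abs_mul, abs_of_nonneg a0]
    gcongr
  · rw [abs_of_nonneg (by positivity), ← sq_abs u]
    gcongr

/-- With `s = √(x ^ 2 + ε ^ 2)`, the product `(1 + x / s) * x` is at least `-ε`, and replacing `x`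
by `u` costs at most `2 * ε`; the sign of `μ` turns this into an upper bound. In the second-order
term `u ^ 2 ≤ 2 * s ^ 2` cancels the singular factor. In the application `x` is the Euler sum and
`u` the true path. -/
lemma smoothPosGen_le_of_near {ε μ : ℝ} (hε : 0 < ε) (hμ : μ ≤ 0) (σ : ℝ) {x u : ℝ}
    (hxu : |x - u| < ε) : smoothPosGen ε μ σ x u ≤ (3 * |μ| + 2 * σ ^ 2) * ε := by
  obtain ⟨a0, a1⟩ := smoothPos_deriv_mem hε x
  have hxs := abs_lt_sqrt_sq_add_sq hε x
  have hs' := smoothPos_le hε.le x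
  have hεs : ε ≤ √(x ^ 2 + ε ^ 2) := le_sqrt_sq_add_sq x
  have hs2 : √(x ^ 2 + ε ^ 2) ^ 2 = x ^ 2 + ε ^ 2 := Real.sq_sqrt (by positivity)
  unfold smoothPos at hs'
  unfold smoothPosGen
  set s := √(x ^ 2 + ε ^ 2)
  have hs0 : 0 < s := hε.trans_le hεs
  have h1 : -((1 + x / s) * x) ≤ ε := by
    rcases le_total 0 x with hx | hx
    · have : 0 ≤ (1 + x / s) * x := by positivity
      linarith
    · rw [abs_of_nonpos hx] at *
      -- For `x ≤ 0`, `smoothPos_le` says `s + x ≤ ε`.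
      have : -((1 + x / s) * x) = (-x) / s * (s + x) := by field_simp
      rw [this]
      calc (-x) / s * (s + x) ≤ 1 * ε := by
            gcongr
            · linarith
            · exact div_le_one_of_le₀ hxs.le hs0.le
            · linarith
        _ = ε := one_mul _
  have h2 : (1 + x / s) * (x - u) ≤ 2 * ε := by
    calc (1 + x / s) * (x - u) ≤ (1 + x / s) * ε := by
          gcongr; exact (le_abs_self _).trans hxu.le
      _ ≤ _ := by gcongr
  have h3 : (1 + x / s) * (μ * u) ≤ 3 * |μ| * ε := by
    rw [abs_of_nonpos hμ]
    have : -((1 + x / s) * u) ≤ 3 * ε := by linarith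
    nlinarith
  have h4 : u ^ 2 ≤ 2 * s ^ 2 := by
    have : (x - u) ^ 2 ≤ ε ^ 2 := by rw [← sq_abs (x - u)]; gcongr
    nlinarith [sq_nonneg (2 * x - u)]
  have h5 : ε ^ 2 / (2 * s ^ 3) * (σ ^ 2 * u ^ 2) ≤ 2 * σ ^ 2 * ε := by
    calc ε ^ 2 / (2 * s ^ 3) * (σ ^ 2 * u ^ 2) ≤ ε ^ 2 / (2 * s ^ 3) * (σ ^ 2 * (2 * s ^ 2)) := by
          gcongr
      _ = ε / s * (σ ^ 2 * ε) := by field_simp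
      _ ≤ 1 * (σ ^ 2 * ε) := by
          gcongr; exact div_le_one_of_le₀ hεs hs0.le
      _ ≤ _ := by nlinarith [mul_nonneg (sq_nonneg σ) hε.le]
  linarith

@[fun_prop]
lemma measurable_smoothPosGen (ε μ σ : ℝ) :
    Measurable fun p : ℝ × ℝ ↦ smoothPosGen ε μ σ p.1 p.2 := by
  unfold smoothPosGen; fun_prop

/-! ### Gaussian moments and a single Euler step -/

/-- Writing `D` in law as `√h * Z` with `Z` standard normal, the variable is at most `√h * (|μ| +
|σ| * |Z|)`, and `√h ^ p ≤ √h ^ 3` for `h ≤ 1`. Summed over `T / h` steps, such errors are of order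
`√h`. -/
lemma exists_integral_abs_pow_gaussian_le (μ σ : ℝ) {p : ℕ} (hp : 3 ≤ p) :
    ∃ C : ℝ, 0 ≤ C ∧ ∀ {Ω : Type*} {_ : MeasurableSpace Ω} (P : Measure Ω) (h : ℝ≥0) (D : Ω → ℝ),
      h ≤ 1 → HasLaw D (gaussianReal 0 h) P →
        Integrable (fun ω ↦ |μ * h + σ * D ω| ^ p) P ∧
        ∫ ω, |μ * h + σ * D ω| ^ p ∂P ≤ C * (h * √h) := by
  refine ⟨∫ z, (|μ| + |σ| * |z|) ^ p ∂(gaussianReal 0 1), by positivity, ?_⟩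
  intro Ω mΩ P h D hh hD
  have hh' : (h : ℝ) ≤ 1 := by exact_mod_cast hh
  have hs1 : √(h : ℝ) ≤ 1 := Real.sqrt_le_one.2 hh'
  have hss : √(h : ℝ) * √(h : ℝ) = h := Real.mul_self_sqrt h.2
  have hmap : (gaussianReal 0 1).map (fun x ↦ √(h : ℝ) * x) = gaussianReal 0 h := by
    rw [gaussianReal_map_const_mul]
    congr 1
    · simp
    · ext; simp
  have hint : Integrable (fun z : ℝ ↦ (|μ| + |σ| * |z|) ^ p) (gaussianReal 0 1) := by
    have h1 : MemLp (fun z : ℝ ↦ |μ| + |σ| * |z|) p (gaussianReal 0 1) := by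
      have h2 : MemLp (id : ℝ → ℝ) (p : ℝ≥0∞) (gaussianReal 0 1) :=
        memLp_id_gaussianReal' _ (by simp)
      have h3 : MemLp (fun z : ℝ ↦ |σ| * |z|) p (gaussianReal 0 1) := h2.abs.const_mul |σ|
      have h4 : MemLp (fun _ : ℝ ↦ |μ|) p (gaussianReal 0 1) := memLp_const _
      exact h4.add h3
    refine (h1.integrable_norm_pow (by omega)).congr (ae_of_all _ fun z ↦ ?_)
    change ‖|μ| + |σ| * |z|‖ ^ p = _
    rw [Real.norm_of_nonneg (by positivity)]
  have hbd : ∀ z : ℝ, |μ * h + σ * (√(h : ℝ) * z)| ^ p ≤ h * √h * (|μ| + |σ| * |z|) ^ p := by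
    intro z
    have h1 : |μ * h + σ * (√(h : ℝ) * z)| ≤ √h * (|μ| + |σ| * |z|) := by
      calc |μ * h + σ * (√(h : ℝ) * z)| ≤ |μ * h| + |σ * (√(h : ℝ) * z)| := abs_add_le _ _
        _ = |μ| * (√h * √h) + |σ| * (√h * |z|) := by
          rw [abs_mul, abs_mul, abs_mul, abs_of_nonneg (Real.sqrt_nonneg _), hss, NNReal.abs_eq]
        _ ≤ |μ| * (√h * 1) + |σ| * (√h * |z|) := by gcongr
        _ = _ := by ring
    calc _ ≤ (√h * (|μ| + |σ| * |z|)) ^ p := by gcongr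
      _ = √h ^ p * (|μ| + |σ| * |z|) ^ p := mul_pow _ _ _
      _ ≤ √h ^ 3 * (|μ| + |σ| * |z|) ^ p := by
        gcongr ?_ * _
        exact pow_le_pow_of_le_one (Real.sqrt_nonneg _) hs1 hp
      _ = _ := by rw [pow_succ, pow_two, hss]
  have hf : Continuous fun x : ℝ ↦ |μ * h + σ * x| ^ p := by fun_prop
  have hg : Integrable (fun z : ℝ ↦ |μ * h + σ * (√(h : ℝ) * z)| ^ p) (gaussianReal 0 1) := by
    refine (hint.const_mul (h * √h)).mono' (by fun_prop) (ae_of_all _ fun z ↦ ?_)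
    rw [Real.norm_of_nonneg (by positivity)]
    exact hbd z
  constructor
  · have : Integrable (fun x : ℝ ↦ |μ * h + σ * x| ^ p) (P.map D) := by
      rw [hD.map_eq, ← hmap, integrable_map_measure hf.aestronglyMeasurable (by fun_prop)]
      exact hg
    exact (integrable_map_measure hf.aestronglyMeasurable hD.aemeasurable).1 this
  · have e := hD.integral_comp (f := fun x : ℝ ↦ |μ * h + σ * x| ^ p) hf.aestronglyMeasurable
    simp only [Function.comp_def] at e
    rw [e, ← hmap, integral_map (by fun_prop) hf.aestronglyMeasurable,
      mul_comm (∫ _, _ ∂_), ← integral_const_mul]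
    exact integral_mono hg (hint.const_mul _) hbd

/-- Moments of a centered Gaussian variable weighted by an independent bounded variable. -/
lemma integral_mul_gaussian_of_indep {Ω : Type*} {m mΩ : MeasurableSpace Ω} {P : Measure Ω}
    [IsProbabilityMeasure P] (hm : m ≤ mΩ) {D ψ : Ω → ℝ} {h : ℝ≥0} {C : ℝ}
    (hD : HasLaw D (gaussianReal 0 h) P)
    (hind : Indep (MeasurableSpace.comap D inferInstance) m P)
    (hψ : Measurable[m] ψ) (hC : ∀ ω, |ψ ω| ≤ C) :
    Integrable (fun ω ↦ ψ ω * D ω) P ∧ ∫ ω, ψ ω * D ω ∂P = 0 ∧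
    Integrable (fun ω ↦ ψ ω * D ω ^ 2) P ∧ ∫ ω, ψ ω * D ω ^ 2 ∂P = h * ∫ ω, ψ ω ∂P := by
  have hψm : AEStronglyMeasurable ψ P := (hψ.mono hm le_rfl).aestronglyMeasurable
  have hL : MemLp D 2 P := by
    have : MemLp id 2 (P.map D) := by
      rw [hD.map_eq]; exact memLp_id_gaussianReal' _ (by simp)
    exact (memLp_map_measure_iff this.1 hD.aemeasurable).1 this
  have hDi : Integrable D P := hL.integrable (by norm_num)
  have hD2 : Integrable (fun ω ↦ D ω ^ 2) P := hL.integrable_sq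
  have hI : IndepFun ψ D P := by
    rw [IndepFun_iff_Indep]
    exact (indep_of_indep_of_le_right hind hψ.comap_le).symm
  have hI2 : IndepFun ψ (fun ω ↦ D ω ^ 2) P := hI.comp measurable_id (measurable_id.pow_const 2)
  have e1 : ∫ ω, D ω ∂P = 0 := by
    rw [hD.integral_eq]; simp
  have e2 : ∫ ω, D ω ^ 2 ∂P = h := by
    rw [← variance_of_integral_eq_zero hD.aemeasurable e1, hD.variance_eq, variance_id_gaussianReal]
  refine ⟨hDi.bdd_mul hψm (ae_of_all _ hC), ?_, hD2.bdd_mul hψm (ae_of_all _ hC), ?_⟩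
  · rw [hI.integral_fun_mul_eq_mul_integral hψm hDi.1, e1, mul_zero]
  · rw [hI2.integral_fun_mul_eq_mul_integral hψm hD2.1, e2, mul_comm]

lemma integrable_smoothPos {Ω : Type*} {mΩ : MeasurableSpace Ω} {P : Measure Ω}
    [IsFiniteMeasure P] {ε : ℝ} (hε : 0 ≤ ε) {X : Ω → ℝ} (hX : Integrable X P) :
    Integrable (fun ω ↦ smoothPos ε (X ω)) P := by
  refine ((hX.add hX.abs).add (integrable_const ε)).mono'
    ((continuous_smoothPos ε).comp_aestronglyMeasurable hX.1) (ae_of_all _ fun ω ↦ ?_)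
  rw [Real.norm_of_nonneg (smoothPos_nonneg _ _)]
  exact smoothPos_le hε _

/-- One Euler step changes the mean of `smoothPos ε` by at most the mean of the generator, up to
an error of order `h ^ (3 / 2)`. -/
lemma exists_integral_smoothPos_step_le {ε : ℝ} (hε : 0 < ε) (μ σ : ℝ) {N : ℝ} (hN : 0 ≤ N) :
    ∃ C : ℝ, 0 ≤ C ∧ ∀ {Ω : Type*} {m mΩ : MeasurableSpace Ω} (P : Measure Ω)
      [IsProbabilityMeasure P] (_ : m ≤ mΩ) (h : ℝ≥0) (D X U : Ω → ℝ),
      h ≤ 1 → HasLaw D (gaussianReal 0 h) P →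
      Indep (MeasurableSpace.comap D inferInstance) m P →
      Measurable[m] X → Measurable[m] U → Integrable X P → (∀ ω, |U ω| ≤ N) →
        Integrable (fun ω ↦ X ω + U ω * (μ * h + σ * D ω)) P ∧
        ∫ ω, smoothPos ε (X ω + U ω * (μ * h + σ * D ω)) ∂P ≤ ∫ ω, smoothPos ε (X ω) ∂P
          + h * ∫ ω, smoothPosGen ε μ σ (X ω) (U ω) ∂P + C * (h * √h) := by
  obtain ⟨C3, hC3, H3⟩ := exists_integral_abs_pow_gaussian_le μ σ (le_refl 3)
  obtain ⟨C6, hC6, H6⟩ := exists_integral_abs_pow_gaussian_le μ σ (show 3 ≤ 6 by norm_num)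
  set K := 3 / ε ^ 2 + 1 / ε ^ 5 with hK
  have hK0 : 0 ≤ K := by positivity
  refine ⟨1 / ε * (N ^ 2 * μ ^ 2) + K * (N ^ 3 * C3 + N ^ 6 * C6), by positivity, ?_⟩
  intro Ω m mΩ P _ hm h D X U hh hD hind hX hU hXi hUN
  obtain ⟨i3, b3⟩ := H3 P h D hh hD
  obtain ⟨i6, b6⟩ := H6 P h D hh hD
  have hh' : (h : ℝ) ≤ 1 := by exact_mod_cast hh
  have hhh : (h : ℝ) * h ≤ h * √h := by
    gcongr
    exact Real.le_sqrt_of_sq_le (by nlinarith [h.2])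
  have hh0 : (0 : ℝ) ≤ h := h.2
  have hXm : Measurable X := hX.mono hm le_rfl
  have hUm : Measurable U := hU.mono hm le_rfl
  set A : Ω → ℝ := fun ω ↦ 1 + X ω / √(X ω ^ 2 + ε ^ 2) with hA
  set B : Ω → ℝ := fun ω ↦ ε ^ 2 / (2 * √(X ω ^ 2 + ε ^ 2) ^ 3) with hB
  have hA0 : ∀ ω, |A ω| ≤ 2 := fun ω ↦ by
    obtain ⟨a, b⟩ := smoothPos_deriv_mem hε (X ω)
    rw [abs_of_nonneg a]; exact b
  have hB0 : ∀ ω, |B ω| ≤ 1 / ε := fun ω ↦ by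
    obtain ⟨a, b⟩ := smoothPos_second_deriv_mem hε (X ω)
    rw [abs_of_nonneg a]; exact b
  have hAm : Measurable[m] A := by fun_prop
  have hBm : Measurable[m] B := by fun_prop
  have hU2 : ∀ ω, |U ω ^ 2| ≤ N ^ 2 := fun ω ↦ by rw [abs_pow]; gcongr; exact hUN ω
  have hBU : ∀ ω, |B ω * U ω ^ 2| ≤ 1 / ε * N ^ 2 := fun ω ↦ by
    rw [abs_mul]; gcongr
    · exact hB0 ω
    · exact hU2 ω
  have hAU : ∀ ω, |A ω * U ω| ≤ 2 * N := fun ω ↦ by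
    rw [abs_mul]; gcongr
    · exact hA0 ω
    · exact hUN ω
  obtain ⟨j1, k1, -, -⟩ := integral_mul_gaussian_of_indep hm hD hind
    (show Measurable[m] (fun ω ↦ A ω * U ω) from hAm.mul hU) hAU
  have hBUm : Measurable[m] (fun ω ↦ B ω * U ω ^ 2) := hBm.mul (hU.pow_const 2)
  obtain ⟨j2, k2, j3, k3⟩ := integral_mul_gaussian_of_indep hm hD hind hBUm hBU
  obtain ⟨j4, -, -, -⟩ := integral_mul_gaussian_of_indep hm hD hind hU hUN
  have iU : Integrable U P := Integrable.of_bound hUm.aestronglyMeasurable N (ae_of_all _ hUN)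
  have iAU : Integrable (fun ω ↦ A ω * U ω) P :=
    Integrable.of_bound ((hAm.mul hU).mono hm le_rfl).aestronglyMeasurable _ (ae_of_all _ hAU)
  have iBU : Integrable (fun ω ↦ B ω * U ω ^ 2) P :=
    Integrable.of_bound (hBUm.mono hm le_rfl).aestronglyMeasurable _ (ae_of_all _ hBU)
  have iY : Integrable (fun ω ↦ X ω + U ω * (μ * h + σ * D ω)) P := by
    have := hXi.add ((iU.mul_const (μ * h)).add (j4.const_mul σ))
    refine this.congr (ae_of_all _ fun ω ↦ ?_)
    simp only [Pi.add_apply]; ring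
  refine ⟨iY, ?_⟩
  have igX := integrable_smoothPos hε.le hXi
  have igY := integrable_smoothPos hε.le iY
  have egen : ∫ ω, smoothPosGen ε μ σ (X ω) (U ω) ∂P
      = μ * ∫ ω, A ω * U ω ∂P + σ ^ 2 * ∫ ω, B ω * U ω ^ 2 ∂P := by
    rw [← integral_const_mul, ← integral_const_mul,
      ← integral_add (iAU.const_mul _) (iBU.const_mul _)]
    refine integral_congr_ae (ae_of_all _ fun ω ↦ ?_)
    simp only [smoothPosGen, hA, hB]; ring
  -- After integration the terms linear in `D` vanish by independence, the `D ^ 2` term completes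
  -- the generator, and the `h * h` term joins the error.
  have key : ∀ ω, smoothPos ε (X ω + U ω * (μ * h + σ * D ω)) ≤ smoothPos ε (X ω)
      + (μ * h) * (A ω * U ω) + σ * (A ω * U ω * D ω)
      + (μ ^ 2 * (h * h)) * (B ω * U ω ^ 2) + (2 * μ * σ * h) * (B ω * U ω ^ 2 * D ω)
      + σ ^ 2 * (B ω * U ω ^ 2 * D ω ^ 2)
      + (K * N ^ 3) * |μ * h + σ * D ω| ^ 3 + (K * N ^ 6) * |μ * h + σ * D ω| ^ 6 := by
    intro ω
    have h1 := smoothPos_add_le hε (X ω) (U ω * (μ * h + σ * D ω))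
    rw [← hK, abs_mul, mul_pow, mul_pow |U ω|, mul_pow |U ω|] at h1
    have h2 : |U ω| ^ 3 * |μ * h + σ * D ω| ^ 3 ≤ N ^ 3 * |μ * h + σ * D ω| ^ 3 := by
      gcongr; exact hUN ω
    have h3 : |U ω| ^ 6 * |μ * h + σ * D ω| ^ 6 ≤ N ^ 6 * |μ * h + σ * D ω| ^ 6 := by
      gcongr; exact hUN ω
    have h4 := mul_le_mul_of_nonneg_left (add_le_add h2 h3) hK0
    refine (h1.trans (add_le_add_right h4 _)).trans_eq ?_
    simp only [hA, hB]; ring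
  have i1 := igX.add (iAU.const_mul (μ * h))
  have i2 := i1.add (j1.const_mul σ)
  have i3' := i2.add (iBU.const_mul (μ ^ 2 * (h * h)))
  have i4 := i3'.add (j2.const_mul (2 * μ * σ * h))
  have i5 := i4.add (j3.const_mul (σ ^ 2))
  have i6' := i5.add (i3.const_mul (K * N ^ 3))
  have i7 := i6'.add (i6.const_mul (K * N ^ 6))
  have h5 := integral_mono igY i7 key
  rw [integral_add' i6' (i6.const_mul _), integral_add' i5 (i3.const_mul _),
    integral_add' i4 (j3.const_mul _), integral_add' i3' (j2.const_mul _),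
    integral_add' i2 (iBU.const_mul _), integral_add' i1 (j1.const_mul _),
    integral_add' igX (iAU.const_mul _)] at h5
  simp only [integral_const_mul] at h5
  rw [k1, k2, k3] at h5
  have e1 : ∫ ω, B ω * U ω ^ 2 ∂P ≤ 1 / ε * N ^ 2 := by
    have := integral_mono iBU (integrable_const (1 / ε * N ^ 2))
      (fun ω ↦ (le_abs_self _).trans (hBU ω))
    simpa using this
  have e2 : μ ^ 2 * (h * h) * ∫ ω, B ω * U ω ^ 2 ∂P ≤ 1 / ε * (N ^ 2 * μ ^ 2) * (h * √h) := by
    calc μ ^ 2 * (h * h) * ∫ ω, B ω * U ω ^ 2 ∂P ≤ μ ^ 2 * (h * h) * (1 / ε * N ^ 2) := by gcongr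
      _ ≤ μ ^ 2 * (h * √h) * (1 / ε * N ^ 2) := by gcongr
      _ = _ := by ring
  have e3 : K * N ^ 3 * ∫ ω, |μ * h + σ * D ω| ^ 3 ∂P ≤ K * N ^ 3 * (C3 * (h * √h)) := by gcongr
  have e4 : K * N ^ 6 * ∫ ω, |μ * h + σ * D ω| ^ 6 ∂P ≤ K * N ^ 6 * (C6 * (h * √h)) := by gcongr
  rw [egen]
  refine h5.trans ?_
  linarith

/-! ### The Euler scheme and its mean under the smoothed positive part -/

/-- The Euler scheme with step `h`, coefficient process `U`, and noise increments `D`. -/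
noncomputable def eulerSum {Ω : Type*} (μ σ z h : ℝ) (U D : ℕ → Ω → ℝ) (k : ℕ) (ω : Ω) : ℝ :=
  z + ∑ i ∈ Finset.range k, U i ω * (μ * h + σ * D i ω)

lemma eulerSum_succ {Ω : Type*} (μ σ z h : ℝ) (U D : ℕ → Ω → ℝ) (k : ℕ) (ω : Ω) :
    eulerSum μ σ z h U D (k + 1) ω
      = eulerSum μ σ z h U D k ω + U k ω * (μ * h + σ * D k ω) := by
  simp only [eulerSum, Finset.sum_range_succ, add_assoc]

lemma measurable_eulerSum {Ω : Type*} {m : ℕ → MeasurableSpace Ω} (hm : Monotone m)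
    (μ σ z h : ℝ) {U D : ℕ → Ω → ℝ} (hU : ∀ i, Measurable[m i] (U i))
    (hD : ∀ i, Measurable[m (i + 1)] (D i)) (k : ℕ) :
    Measurable[m k] (eulerSum μ σ z h U D k) := by
  unfold eulerSum
  refine Measurable.const_add (Finset.measurable_fun_sum _ fun i hi ↦ ?_) z
  rw [Finset.mem_range] at hi
  have h1 : Measurable[m k] (D i) := (hD i).mono (hm hi) le_rfl
  have h2 : Measurable[m k] (U i) := (hU i).mono (hm hi.le) le_rfl
  exact h2.mul ((h1.const_mul σ).const_add (μ * h))

/-- The generator vanishes where `U = 0`, is `O(ε)` where `X` is near `U`, and is bounded elsewhere.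
Excluding `U = 0` from the bad event matters: after stopping, `X` need not be near `U = 0`. -/
lemma integral_smoothPosGen_le {Ω : Type*} {mΩ : MeasurableSpace Ω} (P : Measure Ω)
    [IsProbabilityMeasure P] {ε μ N : ℝ} (hε : 0 < ε) (hμ : μ ≤ 0) (σ : ℝ) {X U : Ω → ℝ}
    (hX : Measurable X) (hU : Measurable U) (hN : ∀ ω, |U ω| ≤ N) :
    ∫ ω, smoothPosGen ε μ σ (X ω) (U ω) ∂P ≤ (3 * |μ| + 2 * σ ^ 2) * ε
      + (2 * (|μ| * N) + 1 / ε * (σ ^ 2 * N ^ 2)) * P.real {ω | U ω ≠ 0 ∧ ε ≤ |X ω - U ω|} := by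
  set K := 2 * (|μ| * N) + 1 / ε * (σ ^ 2 * N ^ 2)
  set s := {ω | U ω ≠ 0 ∧ ε ≤ |X ω - U ω|} with hs
  have hsm : MeasurableSet s := by
    refine MeasurableSet.inter ?_ ?_
    · exact (measurableSet_eq_fun hU measurable_const).compl
    · exact measurableSet_le measurable_const (continuous_abs.measurable.comp (hX.sub hU))
  have hG : Measurable fun ω ↦ smoothPosGen ε μ σ (X ω) (U ω) :=
    (measurable_smoothPosGen ε μ σ).comp (hX.prodMk hU)
  have hb : ∀ ω, |smoothPosGen ε μ σ (X ω) (U ω)| ≤ K := fun ω ↦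
    abs_smoothPosGen_le hε μ σ _ (hN ω)
  have hi : Integrable (fun ω ↦ smoothPosGen ε μ σ (X ω) (U ω)) P :=
    Integrable.of_bound hG.aestronglyMeasurable K (ae_of_all _ hb)
  have hi2 : Integrable (s.indicator fun _ ↦ K) P := (integrable_const K).indicator hsm
  have h := integral_mono hi ((integrable_const ((3 * |μ| + 2 * σ ^ 2) * ε)).add hi2) fun ω ↦ ?_
  · rw [integral_add' (integrable_const _) hi2, integral_indicator_const _ hsm] at h
    simpa [mul_comm] using h
  · have h0 : 0 ≤ (3 * |μ| + 2 * σ ^ 2) * ε := by positivity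
    by_cases hω : ω ∈ s
    · simp only [Pi.add_apply, Set.indicator_of_mem hω]
      linarith [(le_abs_self _).trans (hb ω)]
    · simp only [Pi.add_apply, Set.indicator_of_notMem hω, add_zero]
      by_cases hu : U ω = 0
      · simpa [smoothPosGen, hu] using h0
      · refine smoothPosGen_le_of_near hε hμ σ ?_
        by_contra hc
        exact hω ⟨hu, not_lt.1 hc⟩

/-- The one-step estimates add up. `C` is chosen before `h` and `M`, so the last term vanishes when
the grid is refined with `M * h` fixed. -/
lemma exists_integral_smoothPos_eulerSum_le {ε μ N : ℝ} (hε : 0 < ε) (hμ : μ ≤ 0) (σ z : ℝ)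
    (hN : 0 ≤ N) :
    ∃ C : ℝ, 0 ≤ C ∧ ∀ {Ω : Type*} {mΩ : MeasurableSpace Ω} (P : Measure Ω)
      [IsProbabilityMeasure P] (m : ℕ → MeasurableSpace Ω) (h : ℝ≥0) (U D : ℕ → Ω → ℝ),
      Monotone m → (∀ i, m i ≤ mΩ) → h ≤ 1 → (∀ i, HasLaw (D i) (gaussianReal 0 h) P) →
      (∀ i, Indep (MeasurableSpace.comap (D i) inferInstance) (m i) P) →
      (∀ i, Measurable[m (i + 1)] (D i)) → (∀ i, Measurable[m i] (U i)) →
      (∀ i ω, |U i ω| ≤ N) → ∀ M : ℕ,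
        Integrable (eulerSum μ σ z h U D M) P ∧
        ∫ ω, smoothPos ε (eulerSum μ σ z h U D M ω) ∂P ≤ smoothPos ε z
          + M * h * ((3 * |μ| + 2 * σ ^ 2) * ε)
          + C * ∑ i ∈ Finset.range M,
            h * P.real {ω | U i ω ≠ 0 ∧ ε ≤ |eulerSum μ σ z h U D i ω - U i ω|}
          + C * (M * (h * √h)) := by
  obtain ⟨C₁, hC₁, H⟩ := exists_integral_smoothPos_step_le hε μ σ hN
  set C₂ := 2 * (|μ| * N) + 1 / ε * (σ ^ 2 * N ^ 2)
  have hC₂ : 0 ≤ C₂ := by positivity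
  refine ⟨C₁ + C₂, by positivity, ?_⟩
  intro Ω mΩ P _ m h U D hmono hm hh hD hind hDm hUm hUN M
  have hh0 : (0 : ℝ) ≤ h := h.2
  induction M with
  | zero =>
    have h0 : eulerSum μ σ z h U D 0 = fun _ ↦ z := by ext; simp [eulerSum]
    simp [h0]
  | succ M ih =>
    obtain ⟨i1, b1⟩ := ih
    have hXm := measurable_eulerSum hmono μ σ z h hUm hDm M
    obtain ⟨i2, b2⟩ := H P (hm M) h (D M) _ (U M) hh (hD M) (hind M) hXm (hUm M) i1 (hUN M)
    simp only [← eulerSum_succ] at i2 b2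
    refine ⟨i2, ?_⟩
    have b3 := integral_smoothPosGen_le P hε hμ σ (hXm.mono (hm M) le_rfl)
      ((hUm M).mono (hm M) le_rfl) (hUN M)
    change _ ≤ _ + C₂ * _ at b3
    rw [Finset.sum_range_succ]
    set p := P.real {ω | U M ω ≠ 0 ∧ ε ≤ |eulerSum μ σ z h U D M ω - U M ω|} with hp
    have hp0 : 0 ≤ p := measureReal_nonneg
    have b4 := mul_le_mul_of_nonneg_left b3 hh0
    have b5 : 0 ≤ C₁ * (h * p) := by positivity
    have b6 : 0 ≤ C₂ * (h * √h) := by positivity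
    push_cast
    refine b2.trans ?_
    linarith

/-! ### Riemann sums, convergence in measure, uniform grids -/

/-- Left-endpoint Riemann sums of a continuous function converge to its integral. -/
lemma tendsto_leftRiemannSum {f : ℝ≥0 → ℝ} (hf : Continuous f) {t : ℝ≥0} {m : ℕ → ℕ}
    {p : ℕ → ℕ → ℝ≥0} (hp : ∀ n, Monotone (p n)) (hp0 : ∀ n, p n 0 = 0) (hpm : ∀ n, p n (m n) = t)
    {h : ℕ → ℝ≥0} (hh : Tendsto h atTop (𝓝 0)) (hmesh : ∀ n k, p n (k + 1) ≤ p n k + h n) :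
    Tendsto (fun n ↦ ∑ k ∈ Finset.range (m n), f (p n k) * ((p n (k + 1) : ℝ) - p n k)) atTop
      (𝓝 (∫ s in (0 : ℝ)..t, f s.toNNReal)) := by
  rw [Metric.tendsto_atTop]
  intro η hη
  have hη' : 0 < η / (t + 1) := by positivity
  obtain ⟨δ, hδ, H⟩ := Metric.uniformContinuousOn_iff.1
    ((isCompact_Icc (a := (0 : ℝ≥0)) (b := t)).uniformContinuousOn_of_continuous hf.continuousOn)
    _ hη'
  have hδ' : (0 : ℝ≥0) < δ.toNNReal := by simpa using hδ
  obtain ⟨n₀, hn₀⟩ := eventually_atTop.1 (hh.eventually_lt_const hδ')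
  refine ⟨n₀, fun n hn ↦ ?_⟩
  have hg : Continuous fun s : ℝ ↦ f s.toNNReal := hf.comp continuous_real_toNNReal
  have e1 : ∫ s in (0 : ℝ)..t, f s.toNNReal
      = ∑ k ∈ Finset.range (m n), ∫ s in (p n k : ℝ)..p n (k + 1), f s.toNNReal := by
    rw [intervalIntegral.sum_integral_adjacent_intervals (a := fun k ↦ (p n k : ℝ))
      (fun k _ ↦ hg.intervalIntegrable _ _), hp0, hpm]
    simp
  have e2 : ∑ k ∈ Finset.range (m n), ((p n (k + 1) : ℝ) - p n k) = t := by
    rw [Finset.sum_range_sub (fun k ↦ (p n k : ℝ)), hp0, hpm]; simp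
  have e3 : ∀ k ∈ Finset.range (m n), |f (p n k) * ((p n (k + 1) : ℝ) - p n k)
      - ∫ s in (p n k : ℝ)..p n (k + 1), f s.toNNReal|
      ≤ η / (t + 1) * ((p n (k + 1) : ℝ) - p n k) := by
    intro k hk
    rw [Finset.mem_range] at hk
    have hk1 : p n k ≤ p n (k + 1) := hp n (Nat.le_succ k)
    have hk2 : p n (k + 1) ≤ t := (hp n hk).trans_eq (hpm n)
    have hk1' : (p n k : ℝ) ≤ p n (k + 1) := hk1
    have e4 : f (p n k) * ((p n (k + 1) : ℝ) - p n k)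
        = ∫ _ in (p n k : ℝ)..p n (k + 1), f (p n k) := by
      rw [intervalIntegral.integral_const, smul_eq_mul, mul_comm]
    rw [e4, ← intervalIntegral.integral_sub (by simp) (hg.intervalIntegrable _ _)]
    have := intervalIntegral.norm_integral_le_of_norm_le_const (a := (p n k : ℝ))
      (b := p n (k + 1)) (C := η / (t + 1)) (f := fun s ↦ f (p n k) - f s.toNNReal) ?_
    · rwa [abs_of_nonneg (sub_nonneg.2 hk1')] at this
    · intro s hs
      rw [Set.uIoc_of_le hk1'] at hs
      have hs0 : 0 ≤ s := (p n k).2.trans hs.1.le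
      lift s to ℝ≥0 using hs0
      rw [Real.toNNReal_coe, ← dist_eq_norm]
      have hs1 : p n k < s := hs.1
      have hs2 : s ≤ p n (k + 1) := hs.2
      refine (H _ ⟨zero_le, hk1.trans hk2⟩ _ ⟨zero_le, hs2.trans hk2⟩ ?_).le
      have h3 : (h n : ℝ) < δ := by
        have := hn₀ n hn
        rwa [Real.lt_toNNReal_iff_coe_lt] at this
      have h4 : (p n (k + 1) : ℝ) ≤ p n k + h n := hmesh n k
      rw [dist_comm, NNReal.dist_eq, abs_of_nonneg (sub_nonneg.2 hs.1.le)]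
      linarith [hs.2]
  rw [Real.dist_eq, e1, ← Finset.sum_sub_distrib]
  calc _ ≤ _ := Finset.abs_sum_le_sum_abs _ _
    _ ≤ _ := Finset.sum_le_sum e3
    _ = η / (t + 1) * t := by rw [← Finset.mul_sum, e2]
    _ < η := by
      rw [div_mul_eq_mul_div, div_lt_iff₀ (by positivity)]
      nlinarith

lemma tendstoInMeasure_zero_of_ae_eq_add {Ω : Type*} {mΩ : MeasurableSpace Ω} {P : Measure Ω}
    {f a b : ℕ → Ω → ℝ} (ha : TendstoInMeasure P a atTop fun _ ↦ 0)
    (hb : TendstoInMeasure P b atTop fun _ ↦ 0) (h : ∀ n, ∀ᵐ ω ∂P, f n ω = a n ω + b n ω) :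
    TendstoInMeasure P f atTop fun _ ↦ 0 := by
  rw [tendstoInMeasure_iff_norm] at *
  intro δ hδ
  have h1 := (ha (δ / 2) (by positivity)).add (hb (δ / 2) (by positivity))
  rw [add_zero] at h1
  refine tendsto_of_tendsto_of_tendsto_of_le_of_le tendsto_const_nhds h1 (fun _ ↦ zero_le)
    fun n ↦ ?_
  refine (measure_mono_ae ?_).trans (measure_union_le _ _)
  filter_upwards [h n] with ω hω hmem
  have hmem' : δ ≤ ‖f n ω - 0‖ := hmem
  suffices δ / 2 ≤ ‖a n ω - 0‖ ∨ δ / 2 ≤ ‖b n ω - 0‖ from this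
  by_contra! hc
  simp only [sub_zero, Real.norm_eq_abs] at hmem' hc
  rw [hω] at hmem'
  linarith [abs_add_le (a n ω) (b n ω)]

lemma tendstoInMeasure_sub_limit {Ω : Type*} {mΩ : MeasurableSpace Ω} {P : Measure Ω}
    {f : ℕ → Ω → ℝ} {g : Ω → ℝ} (hf : TendstoInMeasure P f atTop g) :
    TendstoInMeasure P (fun n ω ↦ f n ω - g ω) atTop fun _ ↦ 0 := by
  rw [tendstoInMeasure_iff_norm] at *
  simpa using hf

/-- The integral of a step function on a uniform grid. -/
lemma integral_comp_floor_div (f : ℕ → ℝ) {h : ℝ} (hh : 0 < h) (M : ℕ) :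
    ∫ s in (0 : ℝ)..M * h, f ⌊s / h⌋₊ = ∑ i ∈ Finset.range M, h * f i := by
  have key : ∀ k : ℕ, ∀ s ∈ Set.Ioo (k * h) ((k + 1 : ℕ) * h), f k = f ⌊s / h⌋₊ := by
    intro k s hs
    have : ⌊s / h⌋₊ = k := by
      rw [Nat.floor_eq_iff (div_nonneg ((by positivity : 0 ≤ k * h).trans hs.1.le) hh.le)]
      rw [le_div_iff₀ hh, div_lt_iff₀ hh]
      exact ⟨hs.1.le, by simpa using hs.2⟩
    rw [this]
  have hle : ∀ k : ℕ, k * h ≤ (k + 1 : ℕ) * h := fun k ↦ by gcongr; simp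
  have hae : ∀ k : ℕ, ∀ᵐ s : ℝ, s ∈ Set.uIoc (k * h) ((k + 1 : ℕ) * h) → f k = f ⌊s / h⌋₊ := by
    intro k
    have h1 : ∀ᵐ s : ℝ, s ≠ (k + 1 : ℕ) * h := by simp [ae_iff]
    filter_upwards [h1] with s hs hs'
    rw [Set.uIoc_of_le (hle k)] at hs'
    exact key k s ⟨hs'.1, lt_of_le_of_ne hs'.2 hs⟩
  have h0 := intervalIntegral.sum_integral_adjacent_intervals (μ := volume)
    (f := fun s ↦ f ⌊s / h⌋₊) (a := fun k : ℕ ↦ k * h) (n := M) ?_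
  · simp only [Nat.cast_zero, zero_mul] at h0
    rw [← h0]
    refine Finset.sum_congr rfl fun k _ ↦ ?_
    rw [← intervalIntegral.integral_congr_ae (hae k), intervalIntegral.integral_const, smul_eq_mul]
    push_cast; ring
  · intro k _
    refine (intervalIntegrable_const (c := f k)).congr_ae ?_
    rw [EventuallyEq, ae_restrict_iff' measurableSet_uIoc]
    exact hae k

/-- The increments of `W` on the uniform grid of step `h`. -/
def gridIncrement {Ω : Type*} (W : ℝ≥0 → Ω → ℝ) (h : ℝ≥0) (j : ℕ) (ω : Ω) : ℝ :=
  W ((j + 1 : ℕ) * h) ω - W (j * h) ω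

lemma floor_div_mul_le (t : ℝ≥0) {h : ℝ≥0} (hh : 0 < h) : (⌊(t : ℝ) / h⌋₊ : ℝ≥0) * h ≤ t := by
  rw [← NNReal.coe_le_coe]
  push_cast
  rw [← le_div_iff₀ (by exact_mod_cast hh)]
  exact Nat.floor_le (by positivity)

lemma le_floor_div_add_one_mul (t : ℝ≥0) {h : ℝ≥0} (hh : 0 < h) :
    t ≤ ((⌊(t : ℝ) / h⌋₊ + 1 : ℕ) : ℝ≥0) * h := by
  rw [← NNReal.coe_le_coe]
  push_cast
  rw [← div_le_iff₀ (by exact_mod_cast hh)]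
  exact (Nat.lt_floor_add_one _).le

lemma tendsto_floor_div_mul (t : ℝ≥0) {h : ℕ → ℝ≥0} (hpos : ∀ n, 0 < h n)
    (hh : Tendsto h atTop (𝓝 0)) :
    Tendsto (fun n ↦ (⌊(t : ℝ) / h n⌋₊ : ℝ≥0) * h n) atTop (𝓝 t) := by
  have h1 : Tendsto (fun n ↦ t - h n) atTop (𝓝 t) := by
    simpa using (tendsto_const_nhds (x := t)).sub hh
  refine tendsto_of_tendsto_of_tendsto_of_le_of_le h1 tendsto_const_nhds (fun n ↦ ?_)
    (fun n ↦ floor_div_mul_le t (hpos n))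
  have := le_floor_div_add_one_mul t (hpos n)
  rw [tsub_le_iff_right]
  refine this.trans_eq ?_
  push_cast; ring

/-! ### Convergence of the Euler sums to the solution -/

section

variable {Ω : Type*} {mΩ : MeasurableSpace Ω} {P : Measure Ω} [IsProbabilityMeasure P]
  {F : Filtration ℝ≥0 mΩ} {W S : ℝ≥0 → Ω → ℝ} {μ σ z : ℝ}

lemma measurable_of_stronglyAdapted {X : ℝ≥0 → Ω → ℝ} (hX : StronglyAdapted F X) (t : ℝ≥0) :
    Measurable (X t) :=
  (hX t).measurable.mono (F.le t) le_rfl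

/-- The SDE holds in the limit for Euler sums along partitions of `[0, t]`. -/
lemma IsGeometricBrownianMotion.tendstoInMeasure_partition
    (hS : IsGeometricBrownianMotion P F W S μ σ z) {t : ℝ≥0} {m : ℕ → ℕ} {p : ℕ → ℕ → ℝ≥0}
    (hp : ∀ n, Monotone (p n)) (hp0 : ∀ n, p n 0 = 0) (hpm : ∀ n, p n (m n) = t)
    {h : ℕ → ℝ≥0} (hh : Tendsto h atTop (𝓝 0)) (hmesh : ∀ n k, p n (k + 1) ≤ p n k + h n) :
    TendstoInMeasure P (fun n ω ↦ z + ∑ k ∈ Finset.range (m n),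
      S (p n k) ω * (μ * ((p n (k + 1) : ℝ) - p n k) + σ * (W (p n (k + 1)) ω - W (p n k) ω))
        - S t ω) atTop fun _ ↦ 0 := by
  obtain ⟨I, hI, hSI⟩ := hS.sde t
  have h1 := tendstoInMeasure_sub_limit (hI m p hp hp0 hpm (by
    refine tendsto_of_tendsto_of_tendsto_of_le_of_le tendsto_const_nhds hh (fun _ ↦ zero_le)
      fun n ↦ Finset.sup_le fun k _ ↦ ?_
    rw [tsub_le_iff_left]
    exact hmesh n k))
  have h2 : TendstoInMeasure P (fun n ω ↦ ∑ k ∈ Finset.range (m n),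
      (μ * S (p n k) ω) * ((p n (k + 1) : ℝ) - p n k)) atTop
      (fun ω ↦ ∫ s in (0 : ℝ)..t, μ * S s.toNNReal ω) := by
    refine tendstoInMeasure_of_tendsto_ae (fun n ↦ ?_) ?_
    · refine (Finset.measurable_fun_sum _ fun k _ ↦ ?_).aestronglyMeasurable
      exact ((measurable_of_stronglyAdapted hS.adapted _).const_mul μ).mul_const _
    · filter_upwards [hS.cont] with ω hω
      exact tendsto_leftRiemannSum (f := fun s ↦ μ * S s ω) (hω.const_mul μ) hp hp0 hpm hh hmesh
  refine tendstoInMeasure_zero_of_ae_eq_add (tendstoInMeasure_sub_limit h2) h1 fun n ↦ ?_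
  filter_upwards [hSI, hS.initial] with ω h3 h4
  rw [h3, h4]
  have h5 : ∑ k ∈ Finset.range (m n), S (p n k) ω * (μ * ((p n (k + 1) : ℝ) - p n k)
        + σ * (W (p n (k + 1)) ω - W (p n k) ω))
      = ∑ k ∈ Finset.range (m n), (μ * S (p n k) ω) * ((p n (k + 1) : ℝ) - p n k)
        + ∑ k ∈ Finset.range (m n), σ * S (p n k) ω * (W (p n (k + 1)) ω - W (p n k) ω) := by
    rw [← Finset.sum_add_distrib]
    exact Finset.sum_congr rfl fun k _ ↦ by ring
  rw [h5]; ring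

/-- Cutting the grid off at `t` gives a partition of `[0, t]`; its last, possibly incomplete, cell
is negligible by path continuity. -/
lemma IsGeometricBrownianMotion.tendstoInMeasure_eulerSum
    (hS : IsGeometricBrownianMotion P F W S μ σ z) (t : ℝ≥0) {h : ℕ → ℝ≥0} (hpos : ∀ n, 0 < h n)
    (hh : Tendsto h atTop (𝓝 0)) :
    TendstoInMeasure P (fun n ω ↦
      eulerSum μ σ z (h n) (fun j ↦ S (j * h n)) (gridIncrement W (h n)) ⌊(t : ℝ) / h n⌋₊ ω
        - S (⌊(t : ℝ) / h n⌋₊ * h n) ω) atTop fun _ ↦ 0 := by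
  set i : ℕ → ℕ := fun n ↦ ⌊(t : ℝ) / h n⌋₊ with hi
  set p : ℕ → ℕ → ℝ≥0 := fun n j ↦ min (j * h n) t with hpdef
  have hlo : ∀ n, (i n : ℝ≥0) * h n ≤ t := fun n ↦ floor_div_mul_le t (hpos n)
  have hhi : ∀ n, t ≤ ((i n + 1 : ℕ) : ℝ≥0) * h n := fun n ↦ le_floor_div_add_one_mul t (hpos n)
  have hpi : ∀ n, ∀ j ≤ i n, p n j = j * h n := fun n j hj ↦
    min_eq_left (le_trans (by gcongr) (hlo n))
  have hpm : ∀ n, p n (i n + 1) = t := fun n ↦ min_eq_right (hhi n)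
  have h1 := hS.tendstoInMeasure_partition (t := t) (m := fun n ↦ i n + 1) (p := p)
    (fun n a b hab ↦ by simp only [hpdef]; gcongr) (fun n ↦ by simp [hpdef]) hpm hh (fun n k ↦ by
      simp only [hpdef, Nat.cast_add, Nat.cast_one, add_mul, one_mul, ← min_add_add_right]
      gcongr
      exact le_self_add)
  have h2 : TendstoInMeasure P (fun n ω ↦ S t ω - S (i n * h n) ω
      - S (i n * h n) ω * (μ * ((t : ℝ) - (i n * h n : ℝ≥0)) + σ * (W t ω - W (i n * h n) ω)))
      atTop fun _ ↦ 0 := by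
    refine tendstoInMeasure_of_tendsto_ae (fun n ↦ ?_) ?_
    · have mS := measurable_of_stronglyAdapted hS.adapted
      have mW := measurable_of_stronglyAdapted hS.brownian.adapted
      have m1 := mS t
      have m2 := mS (i n * h n)
      have m3 := mW t
      have m4 := mW (i n * h n)
      exact Measurable.aestronglyMeasurable (by fun_prop)
    · filter_upwards [hS.cont, hS.brownian.isBrownian.cont] with ω hω hω'
      have l := tendsto_floor_div_mul t hpos hh
      have l1 := (hω.tendsto t).comp l
      have l2 := (hω'.tendsto t).comp l
      have l3 := (NNReal.continuous_coe.tendsto t).comp l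
      have l4 := ((tendsto_const_nhds (x := S t ω)).sub l1).sub
        (l1.mul ((((tendsto_const_nhds (x := (t : ℝ))).sub l3).const_mul μ).add
          (((tendsto_const_nhds (x := W t ω)).sub l2).const_mul σ)))
      simpa using l4
  refine tendstoInMeasure_zero_of_ae_eq_add h1 h2 fun n ↦ ae_of_all _ fun ω ↦ ?_
  have h3 : ∑ k ∈ Finset.range (i n), S (p n k) ω * (μ * ((p n (k + 1) : ℝ) - p n k)
        + σ * (W (p n (k + 1)) ω - W (p n k) ω))
      = ∑ k ∈ Finset.range (i n), S (k * h n) ω * (μ * h n + σ * gridIncrement W (h n) k ω) := by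
    refine Finset.sum_congr rfl fun k hk ↦ ?_
    rw [Finset.mem_range] at hk
    rw [hpi n k hk.le, hpi n (k + 1) hk]
    simp only [gridIncrement]
    push_cast; ring
  simp only [Finset.sum_range_succ, h3, hpm, hpi n (i n) le_rfl, eulerSum]
  ring

/-- The sum is the integral over `[0, T]` of a step function bounded by `1` that tends to `0` at
each fixed time, so dominated convergence applies without uniformity in `k`. -/
lemma IsGeometricBrownianMotion.tendsto_average_measure_eulerSum
    (hS : IsGeometricBrownianMotion P F W S μ σ z) {h : ℕ → ℝ≥0} (hpos : ∀ n, 0 < h n)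
    (hh : Tendsto h atTop (𝓝 0)) {T : ℝ} {M : ℕ → ℕ} (hM : ∀ n, M n * h n = T) {δ : ℝ}
    (hδ : 0 < δ) :
    Tendsto (fun n ↦ ∑ k ∈ Finset.range (M n), h n * P.real {ω | δ ≤ |eulerSum μ σ z (h n)
      (fun j ↦ S (j * h n)) (gridIncrement W (h n)) k ω - S (k * h n) ω|}) atTop (𝓝 0) := by
  set f : ℕ → ℕ → ℝ := fun n k ↦ P.real {ω | δ ≤ |eulerSum μ σ z (h n)
      (fun j ↦ S (j * h n)) (gridIncrement W (h n)) k ω - S (k * h n) ω|} with hf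
  have h1 : ∀ n, ∑ k ∈ Finset.range (M n), h n * f n k
      = ∫ s in (0 : ℝ)..T, f n ⌊s / h n⌋₊ := fun n ↦ by
    rw [← hM n, integral_comp_floor_div _ (by exact_mod_cast hpos n)]
  have hT : 0 ≤ T := by rw [← hM 0]; positivity
  change Tendsto (fun n ↦ ∑ k ∈ Finset.range (M n), h n * f n k) atTop (𝓝 0)
  simp only [h1]
  have h2 : Tendsto (fun n ↦ ∫ s in (0 : ℝ)..T, f n ⌊s / h n⌋₊) atTop
      (𝓝 (∫ s in (0 : ℝ)..T, (0 : ℝ))) := by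
    refine intervalIntegral.tendsto_integral_filter_of_dominated_convergence (fun _ ↦ 1)
      (Eventually.of_forall fun n ↦ ?_) (Eventually.of_forall fun n ↦ ae_of_all _ fun s _ ↦ ?_)
      (by simp) (ae_of_all _ fun s hs ↦ ?_)
    · refine Measurable.aestronglyMeasurable ?_
      exact (measurable_from_nat (f := f n)).comp (Nat.measurable_floor.comp (measurable_id.div_const (h n : ℝ)))
    · rw [Real.norm_of_nonneg measureReal_nonneg]
      exact measureReal_le_one
    · rw [Set.uIoc_of_le hT] at hs
      have h3 := hS.tendstoInMeasure_eulerSum ⟨s, hs.1.le⟩ hpos hh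
      rw [tendstoInMeasure_iff_measureReal_norm] at h3
      have h4 := h3 δ hδ
      simp only [sub_zero, Real.norm_eq_abs] at h4
      exact h4
  simpa using h2

end

/-! ### The stopped Euler scheme -/

section

variable {Ω : Type*} {mΩ : MeasurableSpace Ω}

/-- No stopping has occurred up to grid time `i * h`: the path has stayed in `[-N, N]`, and below
the level `β` at every `d`-th grid time. -/
def gridSurvival (S : ℝ≥0 → Ω → ℝ) (h : ℝ≥0) (N β : ℝ) (d i : ℕ) : Set Ω :=
  {ω | ∀ k ≤ i, |S (k * h) ω| ≤ N ∧ (d ∣ k → S (k * h) ω < β)}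

/-- The coefficient process of the stopped Euler scheme. -/
noncomputable def stoppedCoeff (S : ℝ≥0 → Ω → ℝ) (h : ℝ≥0) (N β : ℝ) (d i : ℕ) : Ω → ℝ :=
  (gridSurvival S h N β d i).indicator (S (i * h))

lemma abs_stoppedCoeff_le (S : ℝ≥0 → Ω → ℝ) (h : ℝ≥0) {N : ℝ} (hN : 0 ≤ N) (β : ℝ) (d i : ℕ)
    (ω : Ω) : |stoppedCoeff S h N β d i ω| ≤ N := by
  by_cases hω : ω ∈ gridSurvival S h N β d i
  · rw [stoppedCoeff, Set.indicator_of_mem hω]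
    exact (hω i le_rfl).1
  · rw [stoppedCoeff, Set.indicator_of_notMem hω]
    simpa using hN

lemma measurable_stoppedCoeff {F : Filtration ℝ≥0 mΩ} {S : ℝ≥0 → Ω → ℝ}
    (hS : StronglyAdapted F S) (h : ℝ≥0) (N β : ℝ) (d i : ℕ) :
    Measurable[F (i * h)] (stoppedCoeff S h N β d i) := by
  have hm : ∀ k ≤ i, Measurable[F (i * h)] (S (k * h)) := fun k hk ↦
    (hS _).measurable.mono (F.mono (by gcongr)) le_rfl
  have hset : gridSurvival S h N β d i = ⋂ k ∈ Set.Iic i,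
      {ω | |S (k * h) ω| ≤ N ∧ (d ∣ k → S (k * h) ω < β)} := by
    ext ω; simp [gridSurvival]
  refine (hm i le_rfl).indicator ?_
  rw [hset]
  refine MeasurableSet.biInter (Set.to_countable _) fun k hk ↦ ?_
  have h1 : MeasurableSet[F (i * h)] {ω | |S (k * h) ω| ≤ N} :=
    measurableSet_le (mδ := F (i * h)) (continuous_abs.measurable.comp (hm k hk)) measurable_const
  by_cases hd : d ∣ k
  · simp only [hd, forall_const]
    exact h1.inter (measurableSet_lt (mδ := F (i * h)) (hm k hk) measurable_const)
  · simpa only [hd, false_imp_iff, and_true] using h1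

lemma gridSurvival_anti (S : ℝ≥0 → Ω → ℝ) (h : ℝ≥0) (N β : ℝ) (d : ℕ) {i j : ℕ} (hij : i ≤ j) :
    gridSurvival S h N β d j ⊆ gridSurvival S h N β d i :=
  fun _ hω k hk ↦ hω k (hk.trans hij)

lemma eulerSum_congr (μ σ z h : ℝ) {U V : ℕ → Ω → ℝ} (D : ℕ → Ω → ℝ) {k : ℕ} {ω : Ω}
    (hUV : ∀ i < k, U i ω = V i ω) : eulerSum μ σ z h U D k ω = eulerSum μ σ z h V D k ω := by
  unfold eulerSum
  congr 1
  exact Finset.sum_congr rfl fun i hi ↦ by rw [hUV i (Finset.mem_range.1 hi)]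

lemma eulerSum_eq_of_eq_zero (μ σ z h : ℝ) {U : ℕ → Ω → ℝ} (D : ℕ → Ω → ℝ) {k l : ℕ} (hkl : k ≤ l)
    {ω : Ω} (hU : ∀ i, k ≤ i → U i ω = 0) :
    eulerSum μ σ z h U D l ω = eulerSum μ σ z h U D k ω := by
  induction l, hkl using Nat.le_induction with
  | base => rfl
  | succ l hl ih => rw [eulerSum_succ, ih, hU l hl]; simp

/-- A nonzero coefficient means that stopping has not occurred, so the stopped and plain schemes
still agree. -/
lemma stoppedCoeff_ne_zero_subset (S : ℝ≥0 → Ω → ℝ) (D : ℕ → Ω → ℝ) (h : ℝ≥0) (μ σ z N β ε : ℝ)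
    (d i : ℕ) :
    {ω | stoppedCoeff S h N β d i ω ≠ 0 ∧
      ε ≤ |eulerSum μ σ z h (stoppedCoeff S h N β d) D i ω - stoppedCoeff S h N β d i ω|} ⊆
    {ω | ε ≤ |eulerSum μ σ z h (fun j ↦ S (j * h)) D i ω - S (i * h) ω|} := by
  rintro ω ⟨h1, h2⟩
  have hω : ω ∈ gridSurvival S h N β d i := by
    by_contra hc
    exact h1 (Set.indicator_of_notMem hc _)
  have h3 : ∀ j ≤ i, stoppedCoeff S h N β d j ω = S (j * h) ω := fun j hj ↦
    Set.indicator_of_mem (gridSurvival_anti S h N β d hj hω) _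
  rw [h3 i le_rfl, eulerSum_congr μ σ z h D fun j hj ↦ h3 j hj.le] at h2
  exact h2

/-- If the path reaches `β` at a coarse grid time while bounded by `N`, the stopped Euler scheme
ends at the value which the plain Euler scheme takes at the first such time. -/
lemma exists_eulerSum_stoppedCoeff_eq (S : ℝ≥0 → Ω → ℝ) (D : ℕ → Ω → ℝ) (h : ℝ≥0)
    (μ σ z N β : ℝ) {d J : ℕ} {ω : Ω} (hN : ∀ k ≤ J * d, |S (k * h) ω| ≤ N)
    (hβ : ∃ j ≤ J, β ≤ S ((j * d : ℕ) * h) ω) :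
    ∃ j ≤ J, β ≤ S ((j * d : ℕ) * h) ω ∧
      eulerSum μ σ z h (stoppedCoeff S h N β d) D (J * d) ω
        = eulerSum μ σ z h (fun j ↦ S (j * h)) D (j * d) ω := by
  classical
  have hex : ∃ j, j ≤ J ∧ β ≤ S ((j * d : ℕ) * h) ω := hβ
  obtain ⟨hj1, hj2⟩ := Nat.find_spec hex
  set j := Nat.find hex with hj
  have hmin : ∀ l < j, S ((l * d : ℕ) * h) ω < β := fun l hl ↦ by
    by_contra hc
    exact Nat.find_min hex hl ⟨hl.le.trans hj1, not_lt.1 hc⟩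
  have hle : j * d ≤ J * d := by gcongr
  refine ⟨j, hj1, hj2, ?_⟩
  rw [eulerSum_eq_of_eq_zero μ σ z h D hle]
  · refine eulerSum_congr μ σ z h D fun i hi ↦ ?_
    refine Set.indicator_of_mem (fun k hk ↦ ⟨hN k (by omega), ?_⟩) _
    rintro ⟨l, rfl⟩
    rw [mul_comm d l]
    refine hmin l ?_
    have : l * d < j * d := by rw [mul_comm l d]; omega
    exact lt_of_mul_lt_mul_right this (Nat.zero_le d)
  · intro i hi
    refine Set.indicator_of_notMem (fun hc ↦ ?_) _
    -- From index `j * d` on, the coarse hit itself violates survival, so the scheme is frozen.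
    exact absurd ((hc (j * d) hi).2 (Dvd.intro_left j rfl)) (not_lt.2 hj2)

variable {P : Measure Ω} {F : Filtration ℝ≥0 mΩ} {W S : ℝ≥0 → Ω → ℝ}
  {μ σ z : ℝ}

lemma IsBrownianMotionWrt.hasLaw_gridIncrement (hW : IsBrownianMotionWrt P F W) (h : ℝ≥0)
    (i : ℕ) : HasLaw (gridIncrement W h i) (gaussianReal 0 h) P := by
  have h1 := hW.isBrownian.hasLaw_sub ((i + 1 : ℕ) * h) (i * h)
  change HasLaw (gridIncrement W h i) _ P at h1
  convert h1 using 2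
  ext
  rw [coe_nndist, Real.dist_eq]
  change (h : ℝ) = |((((i + 1 : ℕ) : ℝ≥0) * h : ℝ≥0) : ℝ) - ((i * h : ℝ≥0) : ℝ)|
  push_cast
  rw [show ((i : ℝ) + 1) * h - i * h = h by ring, NNReal.abs_eq]

lemma IsBrownianMotionWrt.indep_gridIncrement (hW : IsBrownianMotionWrt P F W) (h : ℝ≥0)
    (i : ℕ) : Indep (MeasurableSpace.comap (gridIncrement W h i) inferInstance) (F (i * h)) P :=
  hW.indep (i * h) ((i + 1 : ℕ) * h) (by gcongr; simp)

lemma IsBrownianMotionWrt.measurable_gridIncrement (hW : IsBrownianMotionWrt P F W) (h : ℝ≥0)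
    (i : ℕ) : Measurable[F ((i + 1 : ℕ) * h)] (gridIncrement W h i) := by
  have h1 := (hW.adapted ((i + 1 : ℕ) * h)).measurable
  have h2 : Measurable[F ((i + 1 : ℕ) * h)] (W (i * h)) :=
    (hW.adapted _).measurable.mono (F.mono (by gcongr; simp)) le_rfl
  exact h1.sub h2

/-! ### The maximal inequality, from coarse grids to continuous time -/

variable [IsProbabilityMeasure P]

/-- On the event, the stopped scheme ends at the plain Euler value at the first coarse hit, which
exceeds `β - ε` outside a set of measure at most `b n`. There `smoothPos ε` is at least `2 * (β -
ε)`, and Markov's inequality applies; then `n → ∞`. -/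
lemma IsGeometricBrownianMotion.measureReal_coarse_le
    (hS : IsGeometricBrownianMotion P F W S μ σ z) (hμ : μ ≤ 0) {ε β N : ℝ} (hε : 0 < ε)
    (hεβ : ε < β) (hN : 0 ≤ N) {c : ℝ≥0} (hc : 0 < c) (J : ℕ) :
    2 * (β - ε) * P.real {ω | (∃ j ≤ J, β ≤ S (j * c) ω) ∧ ∀ t ≤ J * c, |S t ω| ≤ N}
      ≤ smoothPos ε z + J * c * ((3 * |μ| + 2 * σ ^ 2) * ε) := by
  set G := {ω | (∃ j ≤ J, β ≤ S (j * c) ω) ∧ ∀ t ≤ J * c, |S t ω| ≤ N} with hG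
  obtain ⟨C, hC, H⟩ := exists_integral_smoothPos_eulerSum_le hε hμ σ z hN
  -- Each coarse cell is divided into `n + 1` fine ones, so coarse times are exactly the multiples
  -- of `d = n + 1`.
  set h : ℕ → ℝ≥0 := fun n ↦ c / (n + 1 : ℕ) with hh
  have hpos : ∀ n, 0 < h n := fun n ↦ by positivity
  have hlim : Tendsto h atTop (𝓝 0) := by
    have h1 : Tendsto (fun n : ℕ ↦ c / (n : ℝ≥0)) atTop (𝓝 0) :=
      tendsto_const_div_atTop_nhds_zero_nat c
    exact (tendsto_add_atTop_iff_nat 1).2 h1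
  have hd : ∀ n (j : ℕ), ((j * (n + 1) : ℕ) : ℝ≥0) * h n = j * c := fun n j ↦ by
    simp only [hh]
    have : ((n + 1 : ℕ) : ℝ≥0) ≠ 0 := by positivity
    push_cast at this ⊢
    field_simp
  have hd' : ∀ n (j : ℕ), ((j * (n + 1) : ℕ) : ℝ) * h n = j * c := fun n j ↦ by
    exact_mod_cast congrArg NNReal.toReal (hd n j)
  set Y : ℕ → ℕ → Ω → ℝ := fun n ↦
    eulerSum μ σ z (h n) (fun j ↦ S (j * h n)) (gridIncrement W (h n)) with hY
  set X : ℕ → Ω → ℝ := fun n ↦ eulerSum μ σ z (h n) (stoppedCoeff S (h n) N β (n + 1))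
    (gridIncrement W (h n)) (J * (n + 1)) with hX
  set a : ℕ → ℝ := fun n ↦ ∑ k ∈ Finset.range (J * (n + 1)),
    h n * P.real {ω | ε ≤ |Y n k ω - S (k * h n) ω|} with ha
  set b : ℕ → ℝ := fun n ↦ ∑ j ∈ Finset.range (J + 1),
    P.real {ω | ε ≤ |Y n (j * (n + 1)) ω - S (j * c) ω|} with hb
  have lima : Tendsto a atTop (𝓝 0) :=
    hS.tendsto_average_measure_eulerSum hpos hlim (T := J * c) (fun n ↦ hd' n J) hε
  have limb : Tendsto b atTop (𝓝 0) := by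
    rw [← Finset.sum_const_zero (s := Finset.range (J + 1))]
    refine tendsto_finsetSum _ fun j _ ↦ ?_
    have h1 := hS.tendstoInMeasure_eulerSum (j * c) hpos hlim
    rw [tendstoInMeasure_iff_measureReal_norm] at h1
    have h2 : ∀ n, ⌊((j * c : ℝ≥0) : ℝ) / h n⌋₊ = j * (n + 1) := fun n ↦ by
      have h3 : ((j * c : ℝ≥0) : ℝ) / h n = ((j * (n + 1) : ℕ) : ℝ) := by
        rw [div_eq_iff (by exact_mod_cast (hpos n).ne'), hd' n j]
        simp
      rw [h3, Nat.floor_natCast]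
    simpa only [h2, hd, sub_zero, Real.norm_eq_abs] using h1 ε hε
  have bound : ∀ᶠ n in atTop, 2 * (β - ε) * (P.real G - b n) ≤ smoothPos ε z
      + J * c * ((3 * |μ| + 2 * σ ^ 2) * ε) + C * a n + C * (J * c * √(h n)) := by
    filter_upwards [hlim.eventually_le_const zero_lt_one] with n hn
    obtain ⟨i1, b1⟩ := H P (fun i ↦ F (i * h n)) (h n) (stoppedCoeff S (h n) N β (n + 1))
      (gridIncrement W (h n)) (fun i j hij ↦ F.mono (by gcongr)) (fun i ↦ F.le _) hn
      (hS.brownian.hasLaw_gridIncrement _) (hS.brownian.indep_gridIncrement _)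
      (hS.brownian.measurable_gridIncrement _)
      (measurable_stoppedCoeff hS.adapted _ _ _ _) (abs_stoppedCoeff_le S _ hN β _)
      (J * (n + 1))
    change _ ≤ smoothPos ε z + _ + _ + _ at b1
    have b2 : ∑ i ∈ Finset.range (J * (n + 1)), (h n : ℝ) * P.real
        {ω | stoppedCoeff S (h n) N β (n + 1) i ω ≠ 0 ∧ ε ≤ |eulerSum μ σ z (h n)
          (stoppedCoeff S (h n) N β (n + 1)) (gridIncrement W (h n)) i ω
            - stoppedCoeff S (h n) N β (n + 1) i ω|} ≤ a n := by
      refine Finset.sum_le_sum fun i _ ↦ mul_le_mul_of_nonneg_left ?_ (h n).2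
      exact measureReal_mono (stoppedCoeff_ne_zero_subset S _ _ _ _ _ _ _ _ _ _)
    have b3 := mul_meas_ge_le_integral_of_nonneg (μ := P)
      (ae_of_all _ fun ω ↦ smoothPos_nonneg ε (X n ω)) (integrable_smoothPos hε.le i1)
      (2 * (β - ε))
    have b4 : P.real G ≤ P.real {ω | 2 * (β - ε) ≤ smoothPos ε (X n ω)} + b n := by
      have hsub : G ⊆ {ω | 2 * (β - ε) ≤ smoothPos ε (X n ω)} ∪
          ⋃ j ∈ Finset.range (J + 1), {ω | ε ≤ |Y n (j * (n + 1)) ω - S (j * c) ω|} := by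
        rintro ω ⟨hω1, hω2⟩
        by_cases hω : ∃ j ∈ Finset.range (J + 1), ε ≤ |Y n (j * (n + 1)) ω - S (j * c) ω|
        · right
          simpa using hω
        · left
          push Not at hω
          obtain ⟨j, hj1, hj2, hj3⟩ := exists_eulerSum_stoppedCoeff_eq S (gridIncrement W (h n))
            (h n) μ σ z N β (d := n + 1) (J := J) (ω := ω)
            (fun k hk ↦ hω2 _ (by rw [← hd n J]; gcongr))
            (by simpa only [hd] using hω1)
          rw [hd] at hj2
          have h4 := hω j (Finset.mem_range.2 (by omega))
          change X n ω = Y n (j * (n + 1)) ω at hj3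
          rw [← hj3] at h4
          have h5 := (abs_lt.1 h4).1
          have h6 := two_mul_le_smoothPos ε (X n ω)
          suffices 2 * (β - ε) ≤ smoothPos ε (X n ω) from this
          linarith
      refine (measureReal_mono hsub).trans ((measureReal_union_le _ _).trans ?_)
      gcongr
      exact measureReal_biUnion_finset_le _ _
    have e1 : ((J * (n + 1) : ℕ) : ℝ) * (h n * √(h n)) = J * c * √(h n) := by
      rw [← mul_assoc, hd']
    rw [e1, hd' n J] at b1
    have b5 := mul_le_mul_of_nonneg_left b2 hC
    have b6 : 2 * (β - ε) * (P.real G - b n)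
        ≤ 2 * (β - ε) * P.real {ω | 2 * (β - ε) ≤ smoothPos ε (X n ω)} :=
      mul_le_mul_of_nonneg_left (by linarith) (by linarith)
    linarith
  have hsq : Tendsto (fun n ↦ √(h n : ℝ)) atTop (𝓝 0) := by
    have h1 := (NNReal.continuous_coe.tendsto 0).comp hlim
    have h2 := (Real.continuous_sqrt.tendsto 0).comp h1
    simpa [Function.comp_def] using h2
  have l1 := (limb.const_sub (P.real G)).const_mul (2 * (β - ε))
  have l2 := ((lima.const_mul C).const_add (smoothPos ε z
    + J * c * ((3 * |μ| + 2 * σ ^ 2) * ε))).add ((hsq.const_mul (J * c : ℝ)).const_mul C)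
  simpa using le_of_tendsto_of_tendsto l1 l2 bound

/-- Let `ε → 0`: since `z ≥ 0`, the bound on `smoothPos ε z` tends to `2 * z`. -/
lemma IsGeometricBrownianMotion.mul_measureReal_coarse_le
    (hS : IsGeometricBrownianMotion P F W S μ σ z) (hμ : μ ≤ 0) (hz : 0 ≤ z) {β N : ℝ}
    (hβ : 0 < β) (hN : 0 ≤ N) {c : ℝ≥0} (hc : 0 < c) (J : ℕ) :
    β * P.real {ω | (∃ j ≤ J, β ≤ S (j * c) ω) ∧ ∀ t ≤ J * c, |S t ω| ≤ N} ≤ z := by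
  set p := P.real {ω | (∃ j ≤ J, β ≤ S (j * c) ω) ∧ ∀ t ≤ J * c, |S t ω| ≤ N}
  set K : ℝ := J * c * (3 * |μ| + 2 * σ ^ 2)
  have l1 : Tendsto (fun ε : ℝ ↦ 2 * (β - ε) * p) (𝓝[>] 0) (𝓝 (2 * (β - 0) * p)) :=
    Tendsto.mono_left (Continuous.tendsto (by fun_prop) 0) nhdsWithin_le_nhds
  have l2 : Tendsto (fun ε : ℝ ↦ 2 * z + ε + K * ε) (𝓝[>] 0) (𝓝 (2 * z + 0 + K * 0)) :=
    Tendsto.mono_left (Continuous.tendsto (by fun_prop) 0) nhdsWithin_le_nhds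
  have h := le_of_tendsto_of_tendsto l1 l2 (by
    filter_upwards [Ioo_mem_nhdsGT hβ] with ε hε
    have h1 := hS.measureReal_coarse_le hμ hε.1 hε.2 hN hc J
    have h2 := smoothPos_le hε.1.le z
    rw [abs_of_nonneg hz] at h2
    change 2 * (β - ε) * p ≤ _ at h1
    have h3 : (J : ℝ) * c * ((3 * |μ| + 2 * σ ^ 2) * ε) = K * ε := by ring
    linarith)
  linarith

/-- Continuous paths are bounded on `[0, J * c]`, so the events with bound `N` exhaust this one
almost surely. -/
lemma IsGeometricBrownianMotion.measure_exists_grid_le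
    (hS : IsGeometricBrownianMotion P F W S μ σ z) (hμ : μ ≤ 0) (hz : 0 ≤ z) {β : ℝ}
    (hβ : 0 < β) {c : ℝ≥0} (hc : 0 < c) (J : ℕ) :
    P {ω | ∃ j ≤ J, β ≤ S (j * c) ω} ≤ ENNReal.ofReal (z / β) := by
  set G : ℕ → Set Ω := fun N ↦ {ω | (∃ j ≤ J, β ≤ S (j * c) ω) ∧ ∀ t ≤ J * c, |S t ω| ≤ N}
    with hG
  have hmono : Monotone G := fun N N' hN ω hω ↦
    ⟨hω.1, fun t ht ↦ (hω.2 t ht).trans (by exact_mod_cast hN)⟩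
  have hsub : ({ω | ∃ j ≤ J, β ≤ S (j * c) ω} : Set Ω) ≤ᵐ[P] ⋃ N, G N := by
    filter_upwards [hS.cont] with ω hω hmem
    obtain ⟨C, hC⟩ := (isCompact_Icc (a := (0 : ℝ≥0)) (b := J * c)).exists_bound_of_continuousOn
      hω.continuousOn
    obtain ⟨N, hN⟩ := exists_nat_ge C
    exact Set.mem_iUnion.2 ⟨N, hmem, fun t ht ↦ (hC t ⟨zero_le, ht⟩).trans hN⟩
  refine (measure_mono_ae hsub).trans ?_
  rw [hmono.measure_iUnion]
  refine iSup_le fun N ↦ ?_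
  have h1 := hS.mul_measureReal_coarse_le hμ hz hβ (N := N) (Nat.cast_nonneg N) hc J
  refine ENNReal.le_ofReal_iff_toReal_le (measure_ne_top _ _) (by positivity) |>.2 ?_
  rw [le_div_iff₀ hβ, mul_comm]
  exact h1

lemma IsGeometricBrownianMotion.measure_exists_lt_le
    (hS : IsGeometricBrownianMotion P F W S μ σ z) (hμ : μ ≤ 0) (hz : 0 ≤ z) {β : ℝ}
    (hβ : 0 < β) : P {ω | ∃ t, β < S t ω} ≤ ENNReal.ofReal (z / β) := by
  set c : ℕ → ℝ≥0 := fun r ↦ (1 / 2) ^ r with hc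
  have hpos : ∀ r, 0 < c r := fun r ↦ by positivity
  have hlim : Tendsto c atTop (𝓝 0) :=
    NNReal.tendsto_pow_atTop_nhds_zero_of_lt_one (by rw [← NNReal.coe_lt_coe]; norm_num)
  -- With step `2 ^ (-r)`, `4 ^ r` cells reach time `2 ^ r`: the grids are nested and their union is
  -- dense in the half-line. The strict inequality at `t` passes to nearby grid points.
  set G : ℕ → Set Ω := fun r ↦ {ω | ∃ j : ℕ, j ≤ 4 ^ r ∧ β ≤ S (j * c r) ω} with hG
  have hmono : Monotone G := by
    refine monotone_nat_of_le_succ fun r ω hω ↦ ?_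
    obtain ⟨j, hj, hj'⟩ := hω
    refine ⟨2 * j, by rw [pow_succ]; omega, ?_⟩
    have : ((2 * j : ℕ) : ℝ≥0) * c (r + 1) = j * c r := by
      simp only [hc, pow_succ]
      push_cast
      field_simp
    rwa [this]
  have hsub : ({ω | ∃ t, β < S t ω} : Set Ω) ≤ᵐ[P] ⋃ r, G r := by
    filter_upwards [hS.cont] with ω hω hmem
    obtain ⟨t, ht⟩ := hmem
    have l1 := (hω.tendsto t).comp (tendsto_floor_div_mul t hpos hlim)
    have l2 : ∀ᶠ r : ℕ in atTop, (t : ℝ) ≤ 2 ^ r :=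
      (tendsto_pow_atTop_atTop_of_one_lt (one_lt_two (α := ℝ))).eventually_ge_atTop _
    obtain ⟨r, hr1, hr2⟩ := ((l1.eventually_const_lt ht).and l2).exists
    refine Set.mem_iUnion.2 ⟨r, ⌊(t : ℝ) / c r⌋₊, ?_, hr1.le⟩
    refine Nat.floor_le_of_le ?_
    rw [div_le_iff₀ (by exact_mod_cast hpos r)]
    refine hr2.trans_eq ?_
    simp only [hc]
    push_cast
    rw [← mul_pow]
    norm_num
  refine (measure_mono_ae hsub).trans ?_
  rw [hmono.measure_iUnion]
  exact iSup_le fun r ↦ hS.measure_exists_grid_le hμ hz hβ (hpos r) (4 ^ r)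

end

theorem mainTheorem10 {Ω : Type*} {mΩ : MeasurableSpace Ω} (P : Measure Ω) [IsProbabilityMeasure P]
    (F : Filtration ℝ≥0 mΩ) (W S : ℝ≥0 → Ω → ℝ) (μ σ z : ℝ)
    (hμ : μ < 0) (hσ : 0 < σ) (hz : 0 < z)
    (hS : IsGeometricBrownianMotion P F W S μ σ z) (α : ℝ) (hα : z < α) :
    P {ω | (α : EReal) ≤ ⨆ t : {t : ℝ≥0 // 0 < t}, (S t ω : EReal)} ≤ ENNReal.ofReal (z / α) := by
  have hα0 : 0 < α := hz.trans hα
  -- The supremum need not be attained, but it forces `S` above every `β < α` at some time.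
  have l : Tendsto (fun β : ℝ ↦ ENNReal.ofReal (z / β)) (𝓝[<] α) (𝓝 (ENNReal.ofReal (z / α))) :=
    ENNReal.tendsto_ofReal
      ((tendsto_const_nhds.div tendsto_id hα0.ne').mono_left nhdsWithin_le_nhds)
  refine ge_of_tendsto l ?_
  filter_upwards [Ioo_mem_nhdsLT hα0] with β hβ
  refine (measure_mono fun ω hω ↦ ?_).trans (hS.measure_exists_lt_le hμ.le hz.le hβ.1)
  have h1 : (α : EReal) ≤ ⨆ t : {t : ℝ≥0 // 0 < t}, (S t ω : EReal) := hω
  obtain ⟨t, ht⟩ := lt_iSup_iff.1 ((EReal.coe_lt_coe_iff.2 hβ.2).trans_le h1)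
  exact ⟨t, EReal.coe_lt_coe_iff.1 ht⟩
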